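/- **Corollary (diagonal linear nets, kernel regime).** Let $n\ge 1$ and let $(x_1,y_1),\dots,(x_n,y_n)\in\mathbb{R}^d\times\{-1,+1\}$ be linearly separable training data, i.e. there is $w\in\mathbb{R}^d$ with $y_i\langle w,x_i\rangle>0$ for all $i$ (in particular this holds if $y_i=\operatorname{sign}\langle w^*,x_i\rangle\in\{\pm1\}$ for a ground-truth vector $w^*$). For $\theta=(u,v)\in\mathbb{R}^d\times\mathbb{R}^d\simeq\mathbb{R}^{2d}$ consider the two-layer diagonal linear net $$f(\theta;x)=\sum_{k=1}^d u_k^2x_k-\sum_{k=1}^d v_k^2x_k=\langle w(\theta),x\rangle,\qquad w(\theta):=u^{\odot 2}-v^{\odot 2},$$ and the exponential training loss with weight decay $\lambda>0$, $$\mathcal{L}_\lambda(\theta)=\frac1n\sum_{i=1}^n e^{-y_if(\theta;x_i)}+\frac{\lambda}{2}\|\theta\|_2^2 .$$ Let the weight decay $\lambda=\lambda(\alpha)>0$ depend on the initialization scale $\alpha>0$, with $\lambda(\alpha)=\Theta(\alpha^{-p})$ as $\alpha\to+\infty$ for some constant $p>0$. For each $\alpha>0$ let $\theta(t;\alpha\bar\theta_{\mathrm{init}})$,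 $t\ge 0$, be the solution of the gradient flow $\frac{d\theta}{dt}=-\nabla\mathcal{L}_{\lambda(\alpha)}(\theta)$ started at $\theta(0)=\alpha\bar\theta_{\mathrm{init}}$, $\bar\theta_{\mathrm{init}}=(\mathbf 1,\mathbf 1)$ (such a solution exists on all of $[0,\infty)$). Then the margin $\min_{i}y_i\langle w,x_i\rangle$ has a unique maximizer $w_2^*$ over the unit sphere $\{w\in\mathbb{R}^d:\|w\|_2=1\}$, and for every constant $c\in(0,1)$, with $T_c^-(\alpha):=\frac{1-c}{\lambda(\alpha)}\log\alpha$, $$\lim_{\alpha\to+\infty}\frac{w\big(\theta(T_c^-(\alpha);\alpha\bar\theta_{\mathrm{init}})\big)}{\big\|w\big(\theta(T_c^-(\alpha);\alpha\bar\theta_{\mathrm{init}})\big)\big\|_2}=w_2^*=\operatorname*{arg\,max}_{\|w\|_2=1}\ \min_{1\le i\le n}y_i\langle w,x_i\rangle .$$ -/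

import Mathlib

namespace DiagNet

noncomputable section

/-- Parameters `θ = (u, v) ∈ ℝ^d × ℝ^d ≃ ℝ^{2d}` with the Euclidean norm:
`u k = θ (Sum.inl k)` and `v k = θ (Sum.inr k)`. -/
abbrev Param (d : ℕ) : Type := EuclideanSpace ℝ (Fin d ⊕ Fin d)

/-- The two-layer diagonal linear net `f(θ; x) = ∑ k, u_k² x_k - ∑ k, v_k² x_k`. -/
def net {d : ℕ} (θ : Param d) (x : EuclideanSpace ℝ (Fin d)) : ℝ :=
  ∑ k, θ (Sum.inl k) ^ 2 * x k - ∑ k, θ (Sum.inr k) ^ 2 * x k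

/-- The effective weight `w(θ) = u^{⊙2} - v^{⊙2}`. -/
def effectiveWeight {d : ℕ} (θ : Param d) : EuclideanSpace ℝ (Fin d) :=
  WithLp.toLp 2 fun k => θ (Sum.inl k) ^ 2 - θ (Sum.inr k) ^ 2

/-- The initial direction `(1, 1)`: every coordinate of `u` and of `v` equals one. -/
def initDirection (d : ℕ) : Param d := WithLp.toLp 2 fun _ => 1

/-- The exponential loss `ℓ(ŷ; y) = exp (- y ŷ)`. -/
def expLoss (yhat y : ℝ) : ℝ := Real.exp (-(y * yhat))

/-- The training loss `L(θ) = (1/n) ∑ i, ℓ(f(θ; x_i); y_i)`. -/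
def trainLoss {d n : ℕ} (x : Fin n → EuclideanSpace ℝ (Fin d)) (y : Fin n → ℝ)
    (θ : Param d) : ℝ :=
  (1 / (n : ℝ)) * ∑ i, expLoss (net θ (x i)) (y i)

/-- The training loss with weight decay, `L_lam(θ) = L(θ) + (lam/2) ‖θ‖²`. -/
def regLoss {d n : ℕ} (x : Fin n → EuclideanSpace ℝ (Fin d)) (y : Fin n → ℝ)
    (lam : ℝ) (θ : Param d) : ℝ :=
  trainLoss x y θ + lam / 2 * ‖θ‖ ^ 2

/-- `θ` is a trajectory on `[0, ∞)` of the gradient flow `dθ/dt = -∇F(θ)` with `θ(0) = θ₀`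
(the derivative at `t = 0` is one-sided). -/
def IsGradientFlow {E : Type*} [NormedAddCommGroup E] [InnerProductSpace ℝ E] [CompleteSpace E]
    (F : E → ℝ) (θ₀ : E) (θ : ℝ → E) : Prop :=
  θ 0 = θ₀ ∧
    ∀ t : ℝ, 0 ≤ t → HasDerivWithinAt θ (-(gradient F (θ t))) (Set.Ici 0) t

/-- The margin `min_i y_i ⟪w, x_i⟫` of the linear classifier `w` on the data
(used for `n ≥ 1` only). -/
def margin {d n : ℕ} (x : Fin n → EuclideanSpace ℝ (Fin d)) (y : Fin n → ℝ)
    (w : EuclideanSpace ℝ (Fin d)) : ℝ :=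
  ⨅ i, y i * inner ℝ w (x i)

/-- `argmax_{w ∈ S^{d-1}} min_i y_i ⟪w, x_i⟫`, as the set of all maximizers. -/
def maxL2MarginDirections {d n : ℕ} (x : Fin n → EuclideanSpace ℝ (Fin d)) (y : Fin n → ℝ) :
    Set (EuclideanSpace ℝ (Fin d)) :=
  {w | w ∈ Metric.sphere (0 : EuclideanSpace ℝ (Fin d)) 1 ∧
    IsMaxOn (margin x y) (Metric.sphere (0 : EuclideanSpace ℝ (Fin d)) 1) w}

end

end DiagNet

/-!
With `M = log (α² / λ)` and `v` the vector of least norm such that `y i ⟪v, x i⟫ ≥ 1` for all `i`,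
the flow tracks `M v` as long as `M` stays large, as follows. The products `u k * v k` all equal
`β = α² exp (-2 λ t)`, hence `w = 2 β sinh (ω / 2 β)` coordinatewise, where `ω` solves the kernel
equation `ω' = 8 β F(w) - 2 λ ω` with `F` the negative gradient of the loss. While `‖ω‖² ≪ β` the
weights `w` and `ω` are indistinguishable, and `M = log (β / λ)`, which now decreases at rate `2 λ`,
is the margin at which the force balances the decay. The function `‖ω - M v‖²` decreases at rate
`2 λ` as soon as it exceeds a multiple of `M log M`, because `v` minimizes the norm under the margin
constraints. At time `(1 - c) log α / λ` it is therefore `o(M²)` while `M` is still of order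
`log α`, so that `w` is asymptotically a positive multiple of `v`, which is the maximal margin
direction.
-/

namespace DiagNet

open Set Filter Topology Asymptotics
open scoped InnerProductSpace Manifold

section ODE

variable {E : Type*} [NormedAddCommGroup E]

theorem exists_hasDerivAt_of_hasCompactSupport [NormedSpace ℝ E] [CompleteSpace E] {V : E → E}
    (hV : ContDiff ℝ 1 V) (hc : HasCompactSupport V) (x₀ : E) :
    ∃ θ : ℝ → E, θ 0 = x₀ ∧ ∀ t, HasDerivAt θ (V (θ t)) t := by
  obtain ⟨K, hK⟩ := hV.lipschitzWith_of_hasCompactSupport hc one_ne_zero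
  obtain ⟨C, hC⟩ := hc.exists_bound_of_continuous hV.continuous
  have hlocal (x : E) : ∃ θ : ℝ → E, θ 0 = x ∧
      IsMIntegralCurveOn (I := 𝓘(ℝ, E)) θ V (Ioo (-1) 1) := by
    have hPicard : IsPicardLindelof (fun _ => V) (⟨0, by simp⟩ : Icc (-1 : ℝ) 1) x
        C.toNNReal 0 C.toNNReal K :=
      .of_time_independent (fun x _ => (hC x).trans (Real.le_coe_toNNReal C)) hK.lipschitzOnWith
        (by simp)
    obtain ⟨θ, hθ₀, hθ⟩ := hPicard.exists_eq_forall_mem_Icc_hasDerivWithinAt₀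
    exact ⟨θ, hθ₀, fun t ht => ((hθ t (Ioo_subset_Icc_self ht)).mono
      Ioo_subset_Icc_self).hasFDerivWithinAt.hasMFDerivWithinAt⟩
  obtain ⟨θ, hθ₀, hθ⟩ := exists_isMIntegralCurve_of_isMIntegralCurveOn
    (contMDiff_vectorSpace_iff_contDiff.2 hV) one_pos hlocal x₀
  refine ⟨θ, hθ₀, fun t => ?_⟩
  have hderiv : HasFDerivAt θ ((1 : ℝ →L[ℝ] ℝ).smulRight (V (θ t))) t := (hθ t).hasFDerivAt
  simpa using hderiv.hasDerivAt

theorem exists_hasDerivWithinAt_Ici_of_inner_neg [InnerProductSpace ℝ E] [FiniteDimensional ℝ E]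
    {V : E → E} (hV : ContDiff ℝ 1 V) {R : ℝ} (hR : 0 < R)
    (hin : ∀ x, ‖x‖ = R → ⟪x, V x⟫_ℝ < 0) {x₀ : E} (hx₀ : ‖x₀‖ ≤ R) :
    ∃ θ : ℝ → E, θ 0 = x₀ ∧ ∀ t, 0 ≤ t → HasDerivWithinAt θ (V (θ t)) (Ici 0) t := by
  have := FiniteDimensional.complete ℝ E
  let φ : ContDiffBump (0 : E) := ⟨R, R + 1, hR, by linarith⟩
  have hφ {x : E} (hx : ‖x‖ ≤ R) : φ x • V x = V x := by
    rw [φ.one_of_mem_closedBall (by simpa using hx), one_smul]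
  obtain ⟨θ, hθ₀, hθ⟩ := exists_hasDerivAt_of_hasCompactSupport (V := fun x => φ x • V x)
    (φ.contDiff.smul hV) φ.hasCompactSupport.smul_right x₀
  have hball {t : ℝ} (ht : 0 ≤ t) : ‖θ t‖ ≤ R := by
    refine (sq_le_sq₀ (norm_nonneg _) hR.le).1 <|
      image_le_of_deriv_right_lt_deriv_boundary (f := fun s => ‖θ s‖ ^ 2) (B := fun _ => R ^ 2)
        (fun s _ => ((hθ s).continuousAt.norm.pow 2).continuousWithinAt)
        (fun s _ => (hθ s).norm_sq.hasDerivWithinAt)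
        (by simpa [hθ₀] using pow_le_pow_left₀ (norm_nonneg _) hx₀ 2)
        (fun s => hasDerivAt_const s _) (fun s _ hs => ?_) (right_mem_Icc.2 ht)
    have hs : ‖θ s‖ = R := (sq_eq_sq₀ (norm_nonneg _) hR.le).1 hs
    rw [hφ hs.le]
    linarith [hin _ hs]
  refine ⟨θ, hθ₀, fun t ht => ?_⟩
  rw [← hφ (hball ht)]
  exact (hθ t).hasDerivWithinAt

theorem exists_primitive_Ici [NormedSpace ℝ E] [CompleteSpace E] {g : ℝ → E} {a : ℝ}
    (hg : ContinuousOn g (Ici a)) :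
    ∃ G : ℝ → E, G a = 0 ∧ ∀ t, a ≤ t → HasDerivWithinAt G (g t) (Ici a) t := by
  have hcont : Continuous fun s => g (max s a) :=
    hg.comp_continuous (by fun_prop) fun s => le_max_right s a
  refine ⟨fun t => ∫ s in a..t, g (max s a), by simp, fun t ht => ?_⟩
  simpa [max_eq_left ht] using (hcont.integral_hasStrictDerivAt a t).hasDerivAt.hasDerivWithinAt

theorem eq_mul_exp_of_hasDerivWithinAt {u k K : ℝ → ℝ} {a t : ℝ}
    (hu : ∀ s, a ≤ s → HasDerivWithinAt u (k s * u s) (Ici a) s)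
    (hK : ∀ s, a ≤ s → HasDerivWithinAt K (k s) (Ici a) s) (ht : a ≤ t) :
    u t = u a * Real.exp (K t - K a) := by
  have hconst : u t * Real.exp (-K t) = u a * Real.exp (-K a) :=
    constant_of_has_deriv_right_zero (f := fun s => u s * Real.exp (-K s)) (b := t)
      (fun s hs => ((hu s hs.1).continuousWithinAt.mul
        (hK s hs.1).continuousWithinAt.neg.rexp).mono Icc_subset_Ici_self)
      (fun s hs => (((hu s hs.1).mul (hK s hs.1).neg.exp).mono
        (Ici_subset_Ici.2 hs.1)).congr_deriv (by simp only [Pi.neg_apply]; ring))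
      t (right_mem_Icc.2 ht)
  rw [sub_eq_neg_add, Real.exp_add, ← mul_assoc, ← hconst, mul_assoc, ← Real.exp_add]
  simp

theorem le_exp_decay_of_deriv_right_lt {Q Q' : ℝ → ℝ} {A K r T : ℝ}
    (hQ : ∀ t ∈ Icc 0 T, HasDerivWithinAt Q (Q' t) (Ici 0) t) (h₀ : Q 0 ≤ A + K)
    (hlt : ∀ t ∈ Ico 0 T, Q t = A * Real.exp (-r * t) + K → Q' t < -r * (Q t - K)) :
    ∀ t ∈ Icc 0 T, Q t ≤ A * Real.exp (-r * t) + K := by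
  intro t ht
  refine image_le_of_deriv_right_lt_deriv_boundary
    (B := fun s => A * Real.exp (-r * s) + K) (B' := fun s => A * (Real.exp (-r * s) * -r))
    (fun s hs => (hQ s hs).continuousWithinAt.mono Icc_subset_Ici_self)
    (fun s hs => (hQ s (Ico_subset_Icc_self hs)).mono (Ici_subset_Ici.2 hs.1))
    (by simpa using h₀) (fun s => ?_) (fun s hs hQs => ?_) ht
  · simpa using ((((hasDerivAt_id s).const_mul (-r)).exp.const_mul A).add_const K)
  · refine (hlt s hs hQs).trans_eq ?_
    rw [hQs]
    ring

end ODE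

section ExpLoss

variable {E ι : Type*} [NormedAddCommGroup E] [InnerProductSpace ℝ E] [Fintype ι]

/-- The exponential loss of the linear predictor `w`, averaged over the vectors `z i`. -/
noncomputable def meanExpLoss (z : ι → E) (w : E) : ℝ :=
  (Fintype.card ι : ℝ)⁻¹ * ∑ i, Real.exp (-⟪w, z i⟫_ℝ)

/-- The negative gradient of `meanExpLoss z`: the force which the data exert on `w`. -/
noncomputable def expForce (z : ι → E) (w : E) : E :=
  (Fintype.card ι : ℝ)⁻¹ • ∑ i, Real.exp (-⟪w, z i⟫_ℝ) • z i

theorem inner_expForce (z : ι → E) (w e : E) :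
    ⟪e, expForce z w⟫_ℝ =
      (Fintype.card ι : ℝ)⁻¹ * ∑ i, Real.exp (-⟪w, z i⟫_ℝ) * ⟪e, z i⟫_ℝ := by
  simp only [expForce, real_inner_smul_right, inner_sum]

theorem hasGradientAt_meanExpLoss [CompleteSpace E] (z : ι → E) (w : E) :
    HasGradientAt (meanExpLoss z) (-expForce z w) w := by
  rw [hasGradientAt_iff_hasFDerivAt]
  have hexp (i : ι) : HasFDerivAt (fun w => Real.exp (-⟪w, z i⟫_ℝ))
      (Real.exp (-⟪w, z i⟫_ℝ) • -innerSL ℝ (z i)) w := by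
    simpa only [innerSL_apply_apply, real_inner_comm] using
      ((innerSL ℝ (z i)).hasFDerivAt (x := w)).fun_neg.exp
  refine ((HasFDerivAt.fun_sum fun i _ => hexp i).const_mul _).congr_fderiv ?_
  ext e
  simp [real_inner_comm e, inner_expForce]

theorem contDiff_expForce (z : ι → E) {k : WithTop ℕ∞} : ContDiff ℝ k (expForce z) :=
  contDiff_const.smul (ContDiff.sum fun _ _ =>
    (contDiff_id.inner ℝ contDiff_const).neg.exp.smul contDiff_const)

theorem exp_neg_mul_add_one_le_one (s : ℝ) : Real.exp (-s) * (s + 1) ≤ 1 := by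
  calc Real.exp (-s) * (s + 1) ≤ Real.exp (-s) * Real.exp s := by
        gcongr
        exact Real.add_one_le_exp s
    _ = 1 := by rw [← Real.exp_add, neg_add_cancel, Real.exp_zero]

theorem inner_self_expForce_le_one (z : ι → E) (w : E) : ⟪w, expForce z w⟫_ℝ ≤ 1 := by
  rw [inner_expForce]
  calc (Fintype.card ι : ℝ)⁻¹ * ∑ i, Real.exp (-⟪w, z i⟫_ℝ) * ⟪w, z i⟫_ℝ
      ≤ (Fintype.card ι : ℝ)⁻¹ * ∑ _i : ι, (1 : ℝ) := by
        gcongr with i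
        linarith [exp_neg_mul_add_one_le_one ⟪w, z i⟫_ℝ, Real.exp_pos (-⟪w, z i⟫_ℝ)]
    _ ≤ 1 := by simpa using inv_mul_le_one

end ExpLoss

section GradientFlow

variable {d : ℕ}

theorem inner_effectiveWeight (θ : Param d) (v : EuclideanSpace ℝ (Fin d)) :
    ⟪effectiveWeight θ, v⟫_ℝ = net θ v := by
  simp only [net, effectiveWeight, PiLp.inner_apply, ← Finset.sum_sub_distrib]
  exact Finset.sum_congr rfl fun k _ => by simp; ring

theorem contDiff_effectiveWeight {k : WithTop ℕ∞} :
    ContDiff ℝ k (effectiveWeight : Param d → EuclideanSpace ℝ (Fin d)) := by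
  unfold effectiveWeight
  fun_prop

/-- The adjoint of the derivative of `effectiveWeight` at `θ`, which turns gradients with respect to
the effective weight into gradients with respect to the parameters. -/
noncomputable def weightPullback (θ : Param d) (g : EuclideanSpace ℝ (Fin d)) : Param d :=
  WithLp.toLp 2 (Sum.elim (fun k => 2 * g k * θ (Sum.inl k)) fun k => -2 * g k * θ (Sum.inr k))

theorem weightPullback_neg (θ : Param d) (g : EuclideanSpace ℝ (Fin d)) :
    weightPullback θ (-g) = -weightPullback θ g := by
  ext (k | k) <;> simp [weightPullback]

theorem hasGradientAt_comp_effectiveWeight {φ : EuclideanSpace ℝ (Fin d) → ℝ}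
    {g : EuclideanSpace ℝ (Fin d)} {θ : Param d} (hφ : HasGradientAt φ g (effectiveWeight θ)) :
    HasGradientAt (fun θ => φ (effectiveWeight θ)) (weightPullback θ g) θ := by
  have hproj (j : Fin d ⊕ Fin d) := (EuclideanSpace.proj (𝕜 := ℝ) j).hasFDerivAt (x := θ)
  have hweight : HasFDerivAt effectiveWeight _ θ :=
    (PiLp.hasFDerivAt_toLp 2 _).comp θ (hasFDerivAt_pi.2 fun k =>
      ((hproj (Sum.inl k)).pow 2).sub ((hproj (Sum.inr k)).pow 2))
  refine hasGradientAt_iff_hasFDerivAt.2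
    ((hφ.hasFDerivAt.comp θ hweight).congr_fderiv ?_)
  ext h
  simp only [PiLp.proj_apply, Nat.add_one_sub_one, pow_one, nsmul_eq_mul, Nat.cast_ofNat,
    ContinuousLinearMap.comp_apply, ContinuousLinearMap.coe_pi', sub_apply, smul_apply, smul_eq_mul,
    ContinuousLinearEquiv.coe_coe, PiLp.continuousLinearEquiv_symm_apply,
    InnerProductSpace.toDual_apply_apply, PiLp.inner_apply, RCLike.inner_apply, Real.ringHom_apply,
    weightPullback, neg_mul, Fintype.sum_sum_type, Sum.elim_inl, Sum.elim_inr, mul_neg,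
    ← Finset.sum_add_distrib]
  exact Finset.sum_congr rfl fun k _ => by ring

theorem inner_weightPullback (θ : Param d) (g : EuclideanSpace ℝ (Fin d)) :
    ⟪θ, weightPullback θ g⟫_ℝ = 2 * ⟪effectiveWeight θ, g⟫_ℝ := by
  simp only [weightPullback, effectiveWeight, PiLp.inner_apply, Fintype.sum_sum_type, Sum.elim_inl,
    Sum.elim_inr, RCLike.inner_apply, conj_trivial, Finset.mul_sum, ← Finset.sum_add_distrib]
  exact Finset.sum_congr rfl fun k _ => by ring

/-- The negative gradient of `meanExpLoss z ∘ effectiveWeight` with weight decay `lam`. -/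
noncomputable def flowField {ι : Type*} [Fintype ι] (z : ι → EuclideanSpace ℝ (Fin d)) (lam : ℝ)
    (θ : Param d) : Param d :=
  weightPullback θ (expForce z (effectiveWeight θ)) - lam • θ

theorem contDiff_flowField {ι : Type*} [Fintype ι] (z : ι → EuclideanSpace ℝ (Fin d)) (lam : ℝ)
    {k : WithTop ℕ∞} : ContDiff ℝ k (flowField z lam) := by
  have hforce : ContDiff ℝ k fun θ : Param d => expForce z (effectiveWeight θ) :=
    (contDiff_expForce z).comp contDiff_effectiveWeight
  refine ContDiff.sub (contDiff_euclidean.2 ?_) (by fun_prop)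
  rintro (k | k) <;> simp only [weightPullback, Sum.elim_inl, Sum.elim_inr] <;> fun_prop

variable {n : ℕ} {x : Fin n → EuclideanSpace ℝ (Fin d)} {y : Fin n → ℝ} {lam : ℝ}

theorem trainLoss_eq_meanExpLoss :
    trainLoss x y = fun θ => meanExpLoss (fun i => y i • x i) (effectiveWeight θ) := by
  ext θ
  simp [trainLoss, expLoss, meanExpLoss, real_inner_smul_right, inner_effectiveWeight]

theorem hasGradientAt_regLoss (θ : Param d) :
    HasGradientAt (regLoss x y lam) (-flowField (fun i => y i • x i) lam θ) θ := by
  have hloss : HasGradientAt (trainLoss x y)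
      (weightPullback θ (-expForce (fun i => y i • x i) (effectiveWeight θ))) θ := by
    rw [trainLoss_eq_meanExpLoss]
    exact hasGradientAt_comp_effectiveWeight (hasGradientAt_meanExpLoss _ _)
  refine hasGradientAt_iff_hasFDerivAt.2 ((hloss.hasFDerivAt.add
    ((hasStrictFDerivAt_norm_sq θ).hasFDerivAt.const_mul (lam / 2))).congr_fderiv ?_)
  ext h
  simp only [weightPullback_neg, map_neg, add_apply, neg_apply,
    InnerProductSpace.toDual_apply_apply, smul_apply, coe_innerSL_apply, nsmul_eq_mul,
    Nat.cast_ofNat, smul_eq_mul, flowField, neg_sub, map_sub, map_smul, sub_apply]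
  ring

theorem isGradientFlow_regLoss_iff {θ₀ : Param d} {θ : ℝ → Param d} :
    IsGradientFlow (regLoss x y lam) θ₀ θ ↔ θ 0 = θ₀ ∧ ∀ t, 0 ≤ t →
      HasDerivWithinAt θ (flowField (fun i => y i • x i) lam (θ t)) (Ici 0) t := by
  simp only [IsGradientFlow, (hasGradientAt_regLoss _).gradient, neg_neg]

theorem exists_isGradientFlow_regLoss (hlam : 0 < lam) (θ₀ : Param d) :
    ∃ θ : ℝ → Param d, IsGradientFlow (regLoss x y lam) θ₀ θ := by
  simp only [isGradientFlow_regLoss_iff]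
  have hR : 0 < ‖θ₀‖ ^ 2 + 3 / lam := by positivity
  refine exists_hasDerivWithinAt_Ici_of_inner_neg (contDiff_flowField _ lam) (Real.sqrt_pos.2 hR)
    (fun θ hθ => ?_) (Real.le_sqrt_of_sq_le (by linarith [div_pos three_pos hlam]))
  have hforce := inner_self_expForce_le_one (fun i => y i • x i) (effectiveWeight θ)
  rw [flowField, inner_sub_right, inner_weightPullback, real_inner_smul_right,
    real_inner_self_eq_norm_sq, hθ, Real.sq_sqrt hR.le, mul_add, mul_div_cancel₀ _ hlam.ne']
  linarith [mul_nonneg hlam.le (sq_nonneg ‖θ₀‖)]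

end GradientFlow

section HardMargin

variable {E ι : Type*} [NormedAddCommGroup E] [InnerProductSpace ℝ E] {z : ι → E} {v : E}

/-- The hard-margin vector `v` of the vectors `z i` (in applications `z i = y i • x i`): the vector
of least norm all of whose margins `⟪v, z i⟫` are at least one. -/
structure IsHardMarginVector (z : ι → E) (v : E) : Prop where
  one_le_inner : ∀ i, 1 ≤ ⟪v, z i⟫_ℝ
  norm_le : ∀ w : E, (∀ i, 1 ≤ ⟪w, z i⟫_ℝ) → ‖v‖ ≤ ‖w‖

theorem convex_setOf_one_le_inner (z : ι → E) : Convex ℝ {w : E | ∀ i, 1 ≤ ⟪w, z i⟫_ℝ} := by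
  intro a ha b hb s t hs ht hst i
  rw [inner_add_left, real_inner_smul_left, real_inner_smul_left]
  nlinarith [mul_le_mul_of_nonneg_left (ha i) hs, mul_le_mul_of_nonneg_left (hb i) ht]

theorem exists_isHardMarginVector [CompleteSpace E] [Finite ι]
    (hsep : ∃ w : E, ∀ i, 0 < ⟪w, z i⟫_ℝ) : ∃ v, IsHardMarginVector z v := by
  obtain ⟨w, hw⟩ := hsep
  obtain ⟨r, hr⟩ : ∃ r : ℝ, ∀ i, 1 ≤ r * ⟪w, z i⟫_ℝ := (eventually_all.2 fun i =>
    (tendsto_id.atTop_mul_const (hw i)).eventually_ge_atTop 1).exists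
  have hne : {w : E | ∀ i, 1 ≤ ⟪w, z i⟫_ℝ}.Nonempty :=
    ⟨r • w, fun i => (hr i).trans_eq (real_inner_smul_left _ _ _).symm⟩
  have hclosed : IsClosed {w : E | ∀ i, 1 ≤ ⟪w, z i⟫_ℝ} := by
    simp only [ofPred_forall]
    exact isClosed_iInter fun i => isClosed_le continuous_const (by fun_prop)
  obtain ⟨v, hv, hmin⟩ := exists_norm_eq_iInf_of_complete_convex hne hclosed.isComplete
    (convex_setOf_one_le_inner z) 0
  simp only [zero_sub, norm_neg] at hmin
  exact ⟨v, hv, fun w hw => hmin ▸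
    ciInf_le ⟨0, forall_mem_range.2 fun _ => norm_nonneg _⟩ (⟨w, hw⟩ : {w | ∀ i, 1 ≤ ⟪w, z i⟫_ℝ})⟩

namespace IsHardMarginVector

theorem ne_zero [Nonempty ι] (hv : IsHardMarginVector z v) : v ≠ 0 := by
  rintro rfl
  simpa using (hv.one_le_inner (Classical.arbitrary ι)).trans_lt' zero_lt_one

theorem norm_sq_le_inner (hv : IsHardMarginVector z v) {w : E} (hw : ∀ i, 1 ≤ ⟪w, z i⟫_ℝ) :
    ‖v‖ ^ 2 ≤ ⟪w, v⟫_ℝ := by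
  have hmin : ‖0 - v‖ = ⨅ w : {w : E | ∀ i, 1 ≤ ⟪w, z i⟫_ℝ}, ‖0 - (w : E)‖ := by
    have : Nonempty {w : E | ∀ i, 1 ≤ ⟪w, z i⟫_ℝ} := ⟨⟨v, hv.one_le_inner⟩⟩
    simp only [zero_sub, norm_neg]
    exact le_antisymm (le_ciInf fun w => hv.norm_le w w.2)
      (ciInf_le ⟨0, forall_mem_range.2 fun _ => norm_nonneg _⟩
        (⟨v, hv.one_le_inner⟩ : {w : E | ∀ i, 1 ≤ ⟪w, z i⟫_ℝ}))
  have h := (norm_eq_iInf_iff_real_inner_le_zero (convex_setOf_one_le_inner z)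
    hv.one_le_inner).1 hmin w hw
  rw [zero_sub, inner_neg_left, inner_sub_right, real_inner_self_eq_norm_sq,
    real_inner_comm] at h
  linarith

theorem mul_norm_sq_le_inner (hv : IsHardMarginVector z v) {w : E} {m : ℝ}
    (hw : ∀ i, m ≤ ⟪w, z i⟫_ℝ) : m * ‖v‖ ^ 2 ≤ ⟪w, v⟫_ℝ := by
  rcases le_or_gt m 1 with hm | hm
  · have h := hv.norm_sq_le_inner (w := w + (1 - m) • v) fun i => by
      rw [inner_add_left, real_inner_smul_left]
      nlinarith [hw i, hv.one_le_inner i]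
    rw [inner_add_left, real_inner_smul_left, real_inner_self_eq_norm_sq] at h
    linarith
  · have hm₀ : 0 < m := one_pos.trans hm
    have h := hv.norm_sq_le_inner (w := m⁻¹ • w) fun i => by
      rw [real_inner_smul_left, ← div_eq_inv_mul, one_le_div hm₀]
      exact hw i
    rwa [real_inner_smul_left, ← div_eq_inv_mul, le_div_iff₀' hm₀] at h

end IsHardMarginVector

section MaxMargin

variable {d n : ℕ} {x : Fin n → EuclideanSpace ℝ (Fin d)} {y : Fin n → ℝ}
  {v w : EuclideanSpace ℝ (Fin d)}

theorem margin_mul_norm_sq_le_inner (hv : IsHardMarginVector (fun i => y i • x i) v) :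
    margin x y w * ‖v‖ ^ 2 ≤ ⟪w, v⟫_ℝ :=
  hv.mul_norm_sq_le_inner fun i => by
    rw [real_inner_smul_right]
    exact ciInf_le (finite_range _).bddBelow i

variable [Nonempty (Fin n)]

theorem margin_le_inv_norm (hv : IsHardMarginVector (fun i => y i • x i) v) (hw : ‖w‖ = 1) :
    margin x y w ≤ ‖v‖⁻¹ := by
  have hv₀ : 0 < ‖v‖ := norm_pos_iff.2 hv.ne_zero
  have h : margin x y w * ‖v‖ ^ 2 ≤ ‖v‖ :=
    (margin_mul_norm_sq_le_inner hv).trans ((real_inner_le_norm w v).trans_eq (by simp [hw]))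
  rw [← one_div, le_div_iff₀ hv₀]
  nlinarith

theorem inv_norm_le_margin (hv : IsHardMarginVector (fun i => y i • x i) v) :
    ‖v‖⁻¹ ≤ margin x y (‖v‖⁻¹ • v) := by
  refine le_ciInf fun i => ?_
  rw [real_inner_smul_left, mul_left_comm, ← real_inner_smul_right]
  exact le_mul_of_one_le_right (inv_nonneg.2 (norm_nonneg v)) (hv.one_le_inner i)

theorem eq_inv_norm_smul_of_inv_norm_le_margin
    (hv : IsHardMarginVector (fun i => y i • x i) v) (hw : ‖w‖ = 1)
    (hmargin : ‖v‖⁻¹ ≤ margin x y w) : w = ‖v‖⁻¹ • v := by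
  have hv₀ : 0 < ‖v‖ := norm_pos_iff.2 hv.ne_zero
  have hge : ‖w‖ * ‖v‖ ≤ ⟪w, v⟫_ℝ := by
    calc ‖w‖ * ‖v‖ = ‖v‖⁻¹ * ‖v‖ ^ 2 := by rw [hw]; field_simp
      _ ≤ margin x y w * ‖v‖ ^ 2 := by gcongr
      _ ≤ ⟪w, v⟫_ℝ := margin_mul_norm_sq_le_inner hv
  have hparallel := inner_eq_norm_mul_iff_real.1 ((real_inner_le_norm w v).antisymm hge)
  rwa [hw, one_smul, ← eq_inv_smul_iff₀ hv₀.ne'] at hparallel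

theorem maxL2MarginDirections_eq_singleton (hv : IsHardMarginVector (fun i => y i • x i) v) :
    maxL2MarginDirections x y = {‖v‖⁻¹ • v} := by
  have hunit : ‖‖v‖⁻¹ • v‖ = 1 := norm_smul_inv_norm hv.ne_zero
  ext w
  simp only [maxL2MarginDirections, mem_ofPred_eq, mem_sphere_zero_iff_norm, mem_singleton_iff]
  constructor
  · rintro ⟨hw, hmax⟩
    exact eq_inv_norm_smul_of_inv_norm_le_margin hv hw
      ((inv_norm_le_margin hv).trans (hmax (mem_sphere_zero_iff_norm.2 hunit)))
  · rintro rfl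
    exact ⟨hunit, fun w hw =>
      (margin_le_inv_norm hv (mem_sphere_zero_iff_norm.1 hw)).trans (inv_norm_le_margin hv)⟩

end MaxMargin

end HardMargin

section KernelDynamics

variable {d : ℕ}

/-- The coordinatewise map `ω ↦ 2β sinh (ω / 2β)`, which relates the kernel dynamics to the
effective weight of parameters with `u k * v k = β`. -/
noncomputable def sinhWarp (β : ℝ) (ω : EuclideanSpace ℝ (Fin d)) : EuclideanSpace ℝ (Fin d) :=
  WithLp.toLp 2 fun k => 2 * β * Real.sinh (ω k / (2 * β))

theorem abs_sinh_sub_self_le {s : ℝ} (hs : |s| ≤ 1) : |Real.sinh s - s| ≤ s ^ 2 := by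
  have hpos := abs_le.1 (Real.abs_exp_sub_one_sub_id_le hs)
  have hneg := abs_le.1 (Real.abs_exp_sub_one_sub_id_le (x := -s) (by rwa [abs_neg]))
  rw [Real.sinh_eq, abs_le]
  constructor <;> linarith

theorem abs_sinhWarp_sub_le {β : ℝ} (hβ : 0 < β) {ω : EuclideanSpace ℝ (Fin d)}
    (hω : ‖ω‖ ≤ 2 * β) (k : Fin d) : |sinhWarp β ω k - ω k| ≤ ‖ω‖ / (2 * β) * |ω k| := by
  have hk : |ω k| ≤ ‖ω‖ := PiLp.norm_apply_le ω k
  have hs : |ω k / (2 * β)| ≤ 1 := by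
    rw [abs_div, abs_of_pos (by positivity : 0 < 2 * β), div_le_one (by positivity)]
    exact hk.trans hω
  calc |sinhWarp β ω k - ω k|
      = 2 * β * |Real.sinh (ω k / (2 * β)) - ω k / (2 * β)| := by
        rw [← abs_of_pos (by positivity : 0 < 2 * β), ← abs_mul, mul_sub,
          abs_of_pos (by positivity : 0 < 2 * β), mul_div_cancel₀ _ (by positivity)]
        rfl
    _ ≤ 2 * β * (ω k / (2 * β)) ^ 2 := by
        gcongr
        exact abs_sinh_sub_self_le hs
    _ = |ω k| / (2 * β) * |ω k| := by
        rw [div_pow, ← sq_abs]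
        field_simp
    _ ≤ ‖ω‖ / (2 * β) * |ω k| := by gcongr

theorem norm_sinhWarp_sub_le {β : ℝ} (hβ : 0 < β) {ω : EuclideanSpace ℝ (Fin d)}
    (hω : ‖ω‖ ≤ 2 * β) : ‖sinhWarp β ω - ω‖ ≤ ‖ω‖ ^ 2 / (2 * β) := by
  calc ‖sinhWarp β ω - ω‖ ≤ ‖(‖ω‖ / (2 * β)) • ω‖ := by
        refine (sq_le_sq₀ (norm_nonneg _) (norm_nonneg _)).1 ?_
        rw [EuclideanSpace.norm_sq_eq, EuclideanSpace.norm_sq_eq]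
        refine Finset.sum_le_sum fun k _ => pow_le_pow_left₀ (norm_nonneg _) ?_ 2
        refine (abs_sinhWarp_sub_le hβ hω k).trans_eq ?_
        have hscale : 0 ≤ ‖ω‖ / (2 * β) := by positivity
        rw [PiLp.smul_apply, norm_smul, Real.norm_of_nonneg hscale, Real.norm_eq_abs]
    _ = ‖ω‖ ^ 2 / (2 * β) := by
        rw [norm_smul, Real.norm_eq_abs, abs_of_nonneg (by positivity)]
        ring

/-- The common value at time `t` of the products `u k * v k` along the flow started at
`α • initDirection d`. -/
noncomputable def productScale (lam α t : ℝ) : ℝ := α ^ 2 * Real.exp (-(2 * lam * t))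

theorem productScale_pos {lam α : ℝ} (hα : α ≠ 0) (t : ℝ) : 0 < productScale lam α t := by
  unfold productScale
  positivity

theorem hasDerivAt_productScale (lam α t : ℝ) :
    HasDerivAt (productScale lam α) (-(2 * lam) * productScale lam α t) t := by
  refine (((hasDerivAt_id t).const_mul (2 * lam)).fun_neg.exp.const_mul (α ^ 2)).congr_deriv ?_
  simp only [productScale, id]
  ring

theorem hasDerivWithinAt_apply {ι : Type*} [Fintype ι] {f : ℝ → EuclideanSpace ℝ ι}
    {f' : EuclideanSpace ℝ ι} {s : Set ℝ} {t : ℝ} (hf : HasDerivWithinAt f f' s t) (j : ι) :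
    HasDerivWithinAt (fun t => f t j) (f' j) s t :=
  (EuclideanSpace.proj (𝕜 := ℝ) j).hasFDerivAt.comp_hasDerivWithinAt t hf

variable {ι : Type*} [Fintype ι] {z : ι → EuclideanSpace ℝ (Fin d)} {lam α : ℝ}
  {θ : ℝ → Param d} {G : ℝ → EuclideanSpace ℝ (Fin d)} {t : ℝ}

theorem apply_inl_eq_mul_exp
    (hθ : ∀ t, 0 ≤ t → HasDerivWithinAt θ (flowField z lam (θ t)) (Ici 0) t) (hG₀ : G 0 = 0)
    (hG : ∀ t, 0 ≤ t → HasDerivWithinAt G (expForce z (effectiveWeight (θ t))) (Ici 0) t)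
    (ht : 0 ≤ t) (k : Fin d) :
    θ t (Sum.inl k) = θ 0 (Sum.inl k) * Real.exp (2 * G t k - lam * t) := by
  have h := eq_mul_exp_of_hasDerivWithinAt (u := fun t => θ t (Sum.inl k))
    (fun s hs => (hasDerivWithinAt_apply (hθ s hs) (Sum.inl k)).congr_deriv (by
      simp only [flowField, weightPullback, PiLp.sub_apply, PiLp.smul_apply, Sum.elim_inl,
        smul_eq_mul, ← sub_mul]))
    (fun s hs => ((hasDerivWithinAt_apply (hG s hs) k).const_mul 2).sub
      ((hasDerivWithinAt_id s _).const_mul lam |>.congr_deriv (mul_one _))) ht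
  simpa [hG₀] using h

theorem apply_inr_eq_mul_exp
    (hθ : ∀ t, 0 ≤ t → HasDerivWithinAt θ (flowField z lam (θ t)) (Ici 0) t) (hG₀ : G 0 = 0)
    (hG : ∀ t, 0 ≤ t → HasDerivWithinAt G (expForce z (effectiveWeight (θ t))) (Ici 0) t)
    (ht : 0 ≤ t) (k : Fin d) :
    θ t (Sum.inr k) = θ 0 (Sum.inr k) * Real.exp (-2 * G t k - lam * t) := by
  have h := eq_mul_exp_of_hasDerivWithinAt (u := fun t => θ t (Sum.inr k))
    (fun s hs => (hasDerivWithinAt_apply (hθ s hs) (Sum.inr k)).congr_deriv (by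
      simp only [flowField, weightPullback, PiLp.sub_apply, PiLp.smul_apply, Sum.elim_inr,
        smul_eq_mul, ← sub_mul]))
    (fun s hs => ((hasDerivWithinAt_apply (hG s hs) k).const_mul (-2)).sub
      ((hasDerivWithinAt_id s _).const_mul lam |>.congr_deriv (mul_one _))) ht
  simpa [hG₀] using h

theorem effectiveWeight_eq_sinhWarp (hα : α ≠ 0) (hθ₀ : θ 0 = α • initDirection d)
    (hθ : ∀ t, 0 ≤ t → HasDerivWithinAt θ (flowField z lam (θ t)) (Ici 0) t) (hG₀ : G 0 = 0)
    (hG : ∀ t, 0 ≤ t → HasDerivWithinAt G (expForce z (effectiveWeight (θ t))) (Ici 0) t)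
    (ht : 0 ≤ t) :
    effectiveWeight (θ t) =
      sinhWarp (productScale lam α t) ((8 * productScale lam α t) • G t) := by
  have hβ : productScale lam α t ≠ 0 := (productScale_pos hα t).ne'
  have hinit (j : Fin d ⊕ Fin d) : θ 0 j = α := by simp [hθ₀, initDirection]
  ext k
  have hinl : (2 : ℕ) * (2 * G t k - lam * t) = -(2 * lam * t) + 4 * G t k := by
    push_cast
    ring
  have hinr : (2 : ℕ) * (-2 * G t k - lam * t) = -(2 * lam * t) + -(4 * G t k) := by
    push_cast
    ring
  have harg : (8 * productScale lam α t) * G t k / (2 * productScale lam α t) = 4 * G t k := by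
    field_simp
    ring
  calc θ t (Sum.inl k) ^ 2 - θ t (Sum.inr k) ^ 2
      = 2 * productScale lam α t * Real.sinh (4 * G t k) := by
        rw [apply_inl_eq_mul_exp hθ hG₀ hG ht, apply_inr_eq_mul_exp hθ hG₀ hG ht, hinit, hinit,
          mul_pow, mul_pow, ← Real.exp_nat_mul, ← Real.exp_nat_mul, hinl, hinr, Real.exp_add,
          Real.exp_add, Real.sinh_eq, productScale]
        ring
    _ = sinhWarp (productScale lam α t) ((8 * productScale lam α t) • G t) k := by
        simp only [sinhWarp, PiLp.smul_apply, smul_eq_mul, harg]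

theorem exists_kernel_trajectory (hα : α ≠ 0) (hθ₀ : θ 0 = α • initDirection d)
    (hθ : ∀ t, 0 ≤ t → HasDerivWithinAt θ (flowField z lam (θ t)) (Ici 0) t) :
    ∃ ω : ℝ → EuclideanSpace ℝ (Fin d), ω 0 = 0 ∧
      (∀ t, 0 ≤ t → effectiveWeight (θ t) = sinhWarp (productScale lam α t) (ω t)) ∧
      ∀ t, 0 ≤ t → HasDerivWithinAt ω ((8 * productScale lam α t) •
        expForce z (effectiveWeight (θ t)) - (2 * lam) • ω t) (Ici 0) t := by
  have hforce : ContinuousOn (fun t => expForce z (effectiveWeight (θ t))) (Ici 0) :=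
    ((contDiff_expForce z).comp contDiff_effectiveWeight).continuous (n := 0).comp_continuousOn
      fun t ht => (hθ t ht).continuousWithinAt
  obtain ⟨G, hG₀, hG⟩ := exists_primitive_Ici hforce
  refine ⟨fun t => (8 * productScale lam α t) • G t, by simp [hG₀],
    fun t ht => effectiveWeight_eq_sinhWarp hα hθ₀ hθ hG₀ hG ht, fun t ht => ?_⟩
  refine (((hasDerivAt_productScale lam α t).const_mul 8).hasDerivWithinAt.smul
    (hG t ht)).congr_deriv ?_
  module

end KernelDynamics

section Tracking

theorem exp_neg_mul_add_one_le {k : ℝ} (hk : Real.exp 2 ≤ k) (s : ℝ) :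
    Real.exp (-s) * (s + 1) ≤ 1 + k / 2 * (s + Real.log k) := by
  have hk₀ : 0 < k := (Real.exp_pos 2).trans_le hk
  have hlog : 2 ≤ Real.log k := (Real.le_log_iff_exp_le hk₀).2 hk
  rcases le_or_gt (-Real.log k) s with hs | hs
  · calc Real.exp (-s) * (s + 1) ≤ 1 := exp_neg_mul_add_one_le_one s
      _ ≤ 1 + k / 2 * (s + Real.log k) := le_add_of_nonneg_right
        (mul_nonneg (half_pos hk₀).le (by linarith))
  · have hexp : k ≤ Real.exp (-s) := by
      rw [← Real.log_le_iff_le_exp hk₀]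
      linarith
    calc Real.exp (-s) * (s + 1) ≤ k * (s + 1) :=
          mul_le_mul_of_nonpos_right hexp (by linarith)
      _ ≤ 1 + k / 2 * (s + Real.log k) := by nlinarith

theorem sum_exp_neg_mul_add_one_le {ι : Type*} [Fintype ι] {k : ℝ} (hk : Real.exp 2 ≤ k)
    (s : ι → ℝ) (j : ι) :
    ∑ i, Real.exp (-s i) * (s i + 1) ≤ Fintype.card ι + k / 2 * (s j + Real.log k) := by
  classical
  calc ∑ i, Real.exp (-s i) * (s i + 1)
      ≤ ∑ i, (1 + if i = j then k / 2 * (s j + Real.log k) else 0) := by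
        refine Finset.sum_le_sum fun i _ => ?_
        split_ifs with hij
        · exact hij ▸ exp_neg_mul_add_one_le hk (s i)
        · exact (exp_neg_mul_add_one_le_one (s i)).trans_eq (add_zero 1).symm
    _ = Fintype.card ι + k / 2 * (s j + Real.log k) := by simp [Finset.sum_add_distrib]

variable {E ι : Type*} [NormedAddCommGroup E] [InnerProductSpace ℝ E] [Fintype ι]
  {z : ι → E} {v : E}

namespace IsHardMarginVector

theorem exp_mul_inner_sub_expForce_le (hv : IsHardMarginVector z v) {w ω : E} {M : ℝ} (hM : 0 ≤ M)
    (hclose : ∀ i, |⟪ω - w, z i⟫_ℝ| ≤ 1) :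
    Real.exp M * ⟪ω - M • v, expForce z w⟫_ℝ ≤ (Fintype.card ι : ℝ)⁻¹ *
      ∑ i, Real.exp (-(⟪w, z i⟫_ℝ - M)) * (⟪w, z i⟫_ℝ - M + 1) := by
  rw [inner_expForce, mul_left_comm, Finset.mul_sum]
  refine mul_le_mul_of_nonneg_left (Finset.sum_le_sum fun i _ => ?_) (by positivity)
  rw [← mul_assoc, ← Real.exp_add, neg_sub, ← sub_eq_add_neg]
  refine mul_le_mul_of_nonneg_left ?_ (Real.exp_pos _).le
  have hω := (abs_le.1 (hclose i)).2
  rw [inner_sub_left] at hω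
  rw [inner_sub_left, real_inner_smul_left]
  nlinarith [hv.one_le_inner i]

theorem drift_le [Nonempty ι] (hv : IsHardMarginVector z v) {w ω : E} {M : ℝ} (hM : 0 < M)
    (hlarge : Real.exp 2 ≤ Fintype.card ι * M * ‖v‖ ^ 2 / 2)
    (hclose : ∀ i, |⟪ω - w, z i⟫_ℝ| ≤ 1) :
    8 * Real.exp M * ⟪ω - M • v, expForce z w⟫_ℝ - 2 * M * ⟪ω - M • v, v⟫_ℝ
      ≤ 8 + 2 * M * ‖v‖ ^ 2 * (Real.log (Fintype.card ι * M * ‖v‖ ^ 2 / 2) + 1) := by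
  -- If the least margin `⟪w, z j⟫` is far below `M`, then its term dominates the force, and it
  -- pushes `ω` towards `M • v`; otherwise the least margin bounds `⟪ω - M • v, v⟫` from below.
  obtain ⟨j, hj⟩ := Finite.exists_min fun i => ⟪w, z i⟫_ℝ
  have hforce : Real.exp M * ⟪ω - M • v, expForce z w⟫_ℝ ≤
      1 + M * ‖v‖ ^ 2 / 4 * (⟪w, z j⟫_ℝ - M + Real.log (Fintype.card ι * M * ‖v‖ ^ 2 / 2)) := by
    calc Real.exp M * ⟪ω - M • v, expForce z w⟫_ℝ
        ≤ (Fintype.card ι : ℝ)⁻¹ *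
            ∑ i, Real.exp (-(⟪w, z i⟫_ℝ - M)) * (⟪w, z i⟫_ℝ - M + 1) :=
          hv.exp_mul_inner_sub_expForce_le hM.le hclose
      _ ≤ (Fintype.card ι : ℝ)⁻¹ * (Fintype.card ι + Fintype.card ι * M * ‖v‖ ^ 2 / 2 / 2 *
            (⟪w, z j⟫_ℝ - M + Real.log (Fintype.card ι * M * ‖v‖ ^ 2 / 2))) := by
          gcongr
          exact sum_exp_neg_mul_add_one_le hlarge _ j
      _ = _ := by
          field_simp
          ring
  have hmargin : (⟪w, z j⟫_ℝ - M - 1) * ‖v‖ ^ 2 ≤ ⟪ω - M • v, v⟫_ℝ := by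
    have h := hv.mul_norm_sq_le_inner (w := ω) (m := ⟪w, z j⟫_ℝ - 1) fun i => by
      have hω := (abs_le.1 (hclose i)).1
      rw [inner_sub_left] at hω
      linarith [hj i]
    rw [inner_sub_left, real_inner_smul_left, real_inner_self_eq_norm_sq]
    linarith
  have hmargin' := mul_le_mul_of_nonneg_left hmargin (by positivity : 0 ≤ 2 * M)
  linarith

end IsHardMarginVector

/-- The level at which the squared distance of the kernel dynamics to `M • v` is attracted, where
`v` is the hard-margin vector of `n` vectors and `N = ‖v‖ ^ 2`; it is of order `M log M`. -/
noncomputable def trackingError (n : ℕ) (N M : ℝ) : ℝ :=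
  9 + N + 2 * M * N * (Real.log (n * M * N / 2) + 1)

theorem trackingError_mono {n : ℕ} {N M M' : ℝ} (hN : 0 ≤ N) (hM : 0 ≤ M) (hMM' : M ≤ M')
    (hlarge : Real.exp 2 ≤ n * M * N / 2) : trackingError n N M ≤ trackingError n N M' := by
  have hpos : 0 < n * M * N / 2 := (Real.exp_pos 2).trans_le hlarge
  have hlog : 2 ≤ Real.log (n * M * N / 2) := (Real.le_log_iff_exp_le hpos).2 hlarge
  have hM' : 0 ≤ M' := hM.trans hMM'
  unfold trackingError
  gcongr

theorem one_le_trackingError {n : ℕ} {N M M' : ℝ} (hN : 0 ≤ N) (hM : 0 ≤ M) (hMM' : M ≤ M')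
    (hlarge : Real.exp 2 ≤ n * M * N / 2) : 1 ≤ trackingError n N M' := by
  refine le_trans ?_ (trackingError_mono hN hM hMM' hlarge)
  have hpos : 0 < n * M * N / 2 := (Real.exp_pos 2).trans_le hlarge
  have hlog : 2 ≤ Real.log (n * M * N / 2) := (Real.le_log_iff_exp_le hpos).2 hlarge
  have : 0 ≤ 2 * M * N * (Real.log (n * M * N / 2) + 1) := by positivity
  unfold trackingError
  linarith

theorem IsHardMarginVector.deriv_norm_sub_smul_sq_lt [Nonempty ι] (hv : IsHardMarginVector z v)
    {w ω : E} {M lam : ℝ} (hlam : 0 < lam) (hM : 0 < M)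
    (hlarge : Real.exp 2 ≤ Fintype.card ι * M * ‖v‖ ^ 2 / 2)
    (hclose : ∀ i, |⟪ω - w, z i⟫_ℝ| ≤ 1) :
    2 * ⟪ω - M • v, (8 * (lam * Real.exp M)) • expForce z w - (2 * lam) • ω + (2 * lam) • v⟫_ℝ
      < -(2 * lam) * (‖ω - M • v‖ ^ 2 - trackingError (Fintype.card ι) (‖v‖ ^ 2) M) := by
  have hdrift := hv.drift_le hM hlarge hclose
  set e := ω - M • v with he
  have hωe : ω = e + M • v := by rw [he, sub_add_cancel]
  have hev : 2 * ⟪e, v⟫_ℝ ≤ ‖e‖ ^ 2 + ‖v‖ ^ 2 := by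
    nlinarith [real_inner_le_norm e v, sq_nonneg (‖e‖ - ‖v‖)]
  rw [hωe, inner_add_right, inner_sub_right, real_inner_smul_right, real_inner_smul_right,
    real_inner_smul_right, inner_add_right, real_inner_smul_right, real_inner_self_eq_norm_sq,
    trackingError]
  nlinarith

theorem norm_sq_le_of_norm_sub_smul_sq_le {ω v : E} {m M K : ℝ} (hm : 0 ≤ m) (hmM : m ≤ M)
    (h : ‖ω - m • v‖ ^ 2 ≤ ‖v‖ ^ 2 * M ^ 2 + K) : ‖ω‖ ^ 2 ≤ 4 * ‖v‖ ^ 2 * M ^ 2 + 2 * K := by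
  have hmv : ‖m • v‖ ^ 2 ≤ M ^ 2 * ‖v‖ ^ 2 := by
    rw [norm_smul, mul_pow, Real.norm_of_nonneg hm]
    gcongr
  have hω : ‖ω‖ ≤ ‖ω - m • v‖ + ‖m • v‖ := norm_le_norm_sub_add _ _
  nlinarith [pow_le_pow_left₀ (norm_nonneg _) hω 2, sq_nonneg (‖ω - m • v‖ - ‖m • v‖)]

theorem IsHardMarginVector.norm_sub_smul_sq_le [Nonempty ι] (hv : IsHardMarginVector z v)
    {w ω : ℝ → E} {lam M₀ T : ℝ} (hlam : 0 < lam) (hT : 0 ≤ T) (hMT : 0 < M₀ - 2 * lam * T)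
    (hlarge : Real.exp 2 ≤ Fintype.card ι * (M₀ - 2 * lam * T) * ‖v‖ ^ 2 / 2) (hω₀ : ω 0 = 0)
    (hω : ∀ t, 0 ≤ t → HasDerivWithinAt ω
      ((8 * (lam * Real.exp (M₀ - 2 * lam * t))) • expForce z (w t) - (2 * lam) • ω t) (Ici 0) t)
    (hclose : ∀ t ∈ Icc 0 T, ‖ω t‖ ^ 2 ≤
      4 * ‖v‖ ^ 2 * M₀ ^ 2 + 2 * trackingError (Fintype.card ι) (‖v‖ ^ 2) M₀ →
      ∀ i, |⟪ω t - w t, z i⟫_ℝ| ≤ 1) :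
    ∀ t ∈ Icc 0 T, ‖ω t - (M₀ - 2 * lam * t) • v‖ ^ 2 ≤
      ‖v‖ ^ 2 * M₀ ^ 2 * Real.exp (-(2 * lam) * t) +
        trackingError (Fintype.card ι) (‖v‖ ^ 2) M₀ := by
  set K := trackingError (Fintype.card ι) (‖v‖ ^ 2) M₀
  have hMt {t : ℝ} (ht : t ∈ Icc 0 T) :
      M₀ - 2 * lam * T ≤ M₀ - 2 * lam * t ∧ M₀ - 2 * lam * t ≤ M₀ :=
    ⟨by gcongr; exact ht.2, sub_le_self _ (by have := ht.1; positivity)⟩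
  have hlarge' {t : ℝ} (ht : t ∈ Icc 0 T) :
      Real.exp 2 ≤ Fintype.card ι * (M₀ - 2 * lam * t) * ‖v‖ ^ 2 / 2 := by
    refine hlarge.trans ?_
    gcongr
    exact ht.2
  have hK {t : ℝ} (ht : t ∈ Icc 0 T) :
      trackingError (Fintype.card ι) (‖v‖ ^ 2) (M₀ - 2 * lam * t) ≤ K :=
    trackingError_mono (sq_nonneg _) (hMT.trans_le (hMt ht).1).le (hMt ht).2 (hlarge' ht)
  refine le_exp_decay_of_deriv_right_lt (Q' := fun t => 2 * ⟪ω t - (M₀ - 2 * lam * t) • v,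
      (8 * (lam * Real.exp (M₀ - 2 * lam * t))) • expForce z (w t) - (2 * lam) • ω t +
        (2 * lam) • v⟫_ℝ) (fun t ht => ?_) ?_ fun t ht hQ => ?_
  · have hMv : HasDerivWithinAt (fun s => (M₀ - 2 * lam * s) • v) (-(2 * lam) • v) (Ici 0) t := by
      simpa only [id, mul_one] using
        (((hasDerivWithinAt_id t (Ici 0)).const_mul (2 * lam)).const_sub M₀).smul_const v
    simpa only [neg_smul, sub_neg_eq_add, Pi.sub_apply] using ((hω t ht.1).sub hMv).norm_sq
  · have hK₀ : 1 ≤ K :=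
      one_le_trackingError (sq_nonneg _) hMT.le (hMt (right_mem_Icc.2 hT)).2 hlarge
    rw [hω₀, zero_sub, norm_neg, norm_smul, mul_pow, Real.norm_eq_abs, sq_abs, mul_zero, sub_zero]
    linarith
  · have ht' := Ico_subset_Icc_self ht
    have hMt_pos := hMT.trans_le (hMt ht').1
    have hdecay : Real.exp (-(2 * lam) * t) ≤ 1 := Real.exp_le_one_iff.2 (by nlinarith [ht.1])
    have hω_le := norm_sq_le_of_norm_sub_smul_sq_le hMt_pos.le (hMt ht').2 <| hQ.trans_le <|
      add_le_add_left (mul_le_of_le_one_right (by positivity) hdecay) K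
    have hderiv := hv.deriv_norm_sub_smul_sq_lt hlam hMt_pos (hlarge' ht') (hclose t ht' hω_le)
    nlinarith [hK ht']

theorem mul_norm_sinhWarp_sub_le_one {d : ℕ} {ω : EuclideanSpace ℝ (Fin d)} {β R Z : ℝ}
    (hω : ‖ω‖ ^ 2 ≤ R) (hR : 1 ≤ R) (hZ : 1 ≤ Z) (hZR : Z * R ≤ 2 * β) :
    Z * ‖sinhWarp β ω - ω‖ ≤ 1 := by
  have hRβ : R ≤ 2 * β := (le_mul_of_one_le_left (zero_le_one.trans hR) hZ).trans hZR
  have hβ : 0 < β := by linarith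
  have hωβ : ‖ω‖ ≤ 2 * β := (abs_le_of_sq_le_sq' (by nlinarith) (by linarith)).2
  calc Z * ‖sinhWarp β ω - ω‖ ≤ Z * (‖ω‖ ^ 2 / (2 * β)) := by
        gcongr
        exact norm_sinhWarp_sub_le hβ hωβ
    _ ≤ Z * (R / (2 * β)) := by gcongr
    _ ≤ 1 := by rwa [← mul_div_assoc, div_le_one (by positivity)]

theorem abs_inner_sub_sinhWarp_le_one {d : ℕ} {ω ζ : EuclideanSpace ℝ (Fin d)} {β R Z : ℝ}
    (hω : ‖ω‖ ^ 2 ≤ R) (hR : 1 ≤ R) (hZ : 1 ≤ Z) (hZR : Z * R ≤ 2 * β) (hζ : ‖ζ‖ ≤ Z) :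
    |⟪ω - sinhWarp β ω, ζ⟫_ℝ| ≤ 1 :=
  calc |⟪ω - sinhWarp β ω, ζ⟫_ℝ| ≤ ‖ω - sinhWarp β ω‖ * ‖ζ‖ := abs_real_inner_le_norm _ _
    _ ≤ Z * ‖sinhWarp β ω - ω‖ := by rw [norm_sub_rev, mul_comm]; gcongr
    _ ≤ 1 := mul_norm_sinhWarp_sub_le_one hω hR hZ hZR

theorem norm_sinhWarp_sub_sq_le {d : ℕ} {ω e : EuclideanSpace ℝ (Fin d)} {β R Z : ℝ}
    (hω : ‖ω‖ ^ 2 ≤ R) (hR : 1 ≤ R) (hZ : 1 ≤ Z) (hZR : Z * R ≤ 2 * β) :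
    ‖sinhWarp β ω - e‖ ^ 2 ≤ 2 * ‖ω - e‖ ^ 2 + 2 := by
  have hwarp : ‖sinhWarp β ω - ω‖ ≤ 1 :=
    (le_mul_of_one_le_left (norm_nonneg _) hZ).trans (mul_norm_sinhWarp_sub_le_one hω hR hZ hZR)
  calc ‖sinhWarp β ω - e‖ ^ 2 ≤ (‖sinhWarp β ω - ω‖ + ‖ω - e‖) ^ 2 := by
        gcongr
        exact norm_sub_le_norm_sub_add_norm_sub _ _ _
    _ ≤ 2 * (‖sinhWarp β ω - ω‖ ^ 2 + ‖ω - e‖ ^ 2) := add_sq_le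
    _ ≤ 2 * ‖ω - e‖ ^ 2 + 2 := by nlinarith [norm_nonneg (sinhWarp β ω - ω)]

theorem productScale_eq_mul_exp {lam α M₀ : ℝ} (hα : α ^ 2 = lam * Real.exp M₀) (t : ℝ) :
    productScale lam α t = lam * Real.exp (M₀ - 2 * lam * t) := by
  rw [productScale, hα, mul_assoc, ← Real.exp_add, sub_eq_add_neg]

theorem IsHardMarginVector.norm_effectiveWeight_sub_smul_sq_le {d : ℕ} {ι : Type*} [Fintype ι]
    [Nonempty ι] {z : ι → EuclideanSpace ℝ (Fin d)} {v : EuclideanSpace ℝ (Fin d)}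
    (hv : IsHardMarginVector z v) {lam α M₀ T Z : ℝ} {θ : ℝ → Param d} (hlam : 0 < lam)
    (hα : α ^ 2 = lam * Real.exp M₀) (hT : 0 ≤ T) (hMT : 0 < M₀ - 2 * lam * T)
    (hlarge : Real.exp 2 ≤ Fintype.card ι * (M₀ - 2 * lam * T) * ‖v‖ ^ 2 / 2)
    (hZ : 1 ≤ Z) (hz : ∀ i, ‖z i‖ ≤ Z)
    (hscale : Z * (4 * ‖v‖ ^ 2 * M₀ ^ 2 + 2 * trackingError (Fintype.card ι) (‖v‖ ^ 2) M₀) ≤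
      2 * productScale lam α T)
    (hθ₀ : θ 0 = α • initDirection d)
    (hθ : ∀ t, 0 ≤ t → HasDerivWithinAt θ (flowField z lam (θ t)) (Ici 0) t) :
    ‖effectiveWeight (θ T) - (M₀ - 2 * lam * T) • v‖ ^ 2 ≤
      2 * (‖v‖ ^ 2 * M₀ ^ 2 * Real.exp (-(2 * lam) * T) +
        trackingError (Fintype.card ι) (‖v‖ ^ 2) M₀) + 2 := by
  have hα₀ : α ≠ 0 := sq_pos_iff.1 (hα ▸ mul_pos hlam (Real.exp_pos M₀))
  obtain ⟨ω, hω₀, hw, hω⟩ := exists_kernel_trajectory hα₀ hθ₀ hθ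
  have hMT_le : M₀ - 2 * lam * T ≤ M₀ := sub_le_self _ (by positivity)
  set K := trackingError (Fintype.card ι) (‖v‖ ^ 2) M₀
  have hK : 1 ≤ K := one_le_trackingError (sq_nonneg ‖v‖) hMT.le hMT_le hlarge
  have hR : 1 ≤ 4 * ‖v‖ ^ 2 * M₀ ^ 2 + 2 * K := by nlinarith [sq_nonneg (‖v‖ * M₀)]
  have hscale' {t : ℝ} (ht : t ≤ T) :
      Z * (4 * ‖v‖ ^ 2 * M₀ ^ 2 + 2 * K) ≤ 2 * productScale lam α t := by
    refine hscale.trans ?_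
    rw [productScale_eq_mul_exp hα, productScale_eq_mul_exp hα]
    gcongr
  have htrack := hv.norm_sub_smul_sq_le hlam hT hMT hlarge hω₀
    (fun t ht => productScale_eq_mul_exp hα t ▸ hω t ht)
    (fun t ht hωR i => hw t ht.1 ▸ abs_inner_sub_sinhWarp_le_one hωR hR hZ (hscale' ht.2) (hz i))
    T (right_mem_Icc.2 hT)
  have hdecay : Real.exp (-(2 * lam) * T) ≤ 1 := Real.exp_le_one_iff.2 (by nlinarith)
  have hωR := norm_sq_le_of_norm_sub_smul_sq_le hMT.le hMT_le <| htrack.trans <|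
    add_le_add_left (mul_le_of_le_one_right (by positivity) hdecay) K
  rw [hw T hT]
  linarith [norm_sinhWarp_sub_sq_le (e := (M₀ - 2 * lam * T) • v) hωR hR hZ hscale]

end Tracking

section Asymptotics

theorem tendsto_inv_norm_smul_of_isLittleO {α E : Type*} [NormedAddCommGroup E] [NormedSpace ℝ E]
    {l : Filter α} {w : α → E} {m : α → ℝ} {v : E} (hv : v ≠ 0) (hm : ∀ᶠ a in l, 0 < m a)
    (hw : (fun a => w a - m a • v) =o[l] m) :
    Tendsto (fun a => ‖w a‖⁻¹ • w a) l (𝓝 (‖v‖⁻¹ • v)) := by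
  have hscaled : Tendsto (fun a => (m a)⁻¹ • w a) l (𝓝 v) := by
    refine (zero_add v ▸ hw.tendsto_inv_smul_nhds_zero.add_const v).congr' ?_
    filter_upwards [hm] with a ha
    rw [smul_sub, inv_smul_smul₀ ha.ne', sub_add_cancel]
  refine ((hscaled.norm.inv₀ (norm_ne_zero_iff.2 hv)).smul hscaled).congr' ?_
  filter_upwards [hm] with a ha
  rw [norm_smul, norm_inv, Real.norm_of_nonneg ha.le, mul_inv, inv_inv, smul_smul,
    mul_right_comm, mul_inv_cancel₀ ha.ne', one_mul]

theorem isLittleO_trackingError_sq {n : ℕ} {N : ℝ} (hn : 0 < n) (hN : 0 < N) :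
    trackingError n N =o[atTop] fun M => M ^ 2 := by
  have hscale : Tendsto (fun M : ℝ => n * M * N / 2) atTop atTop := by
    refine (tendsto_id.const_mul_atTop (by positivity : 0 < n * N / 2)).congr fun M => ?_
    simp only [id]
    ring
  have hlog : (fun M : ℝ => Real.log (n * M * N / 2) + 1) =o[atTop] fun M => M := by
    refine ((Real.isLittleO_log_id_atTop.comp_tendsto hscale).trans_isBigO ?_).add
      (isLittleO_const_id_atTop 1)
    refine (isBigO_refl (fun M : ℝ => M) atTop).const_mul_left (n * N / 2) |>.congr_left fun M => ?_
    simp only [Function.comp_apply, id]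
    ring
  have hconst : (fun _ : ℝ => 9 + N) =o[atTop] fun M : ℝ => M ^ 2 :=
    isLittleO_const_left.2 (Or.inr (tendsto_norm_atTop_atTop.comp (tendsto_pow_atTop two_ne_zero)))
  refine hconst.add (((((isBigO_refl (fun M : ℝ => M) atTop).const_mul_left (2 * N)).mul_isLittleO
    hlog).congr ?_ ?_))
  · intro M
    ring
  · intro M
    ring

variable {f lam : ℝ → ℝ} {p q s c : ℝ}

theorem eventually_log_le_of_isBigO_rpow (hpos : ∀ᶠ α in atTop, 0 < f α)
    (hf : f =O[atTop] fun α => α ^ p) (hpq : p < q) :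
    ∀ᶠ α in atTop, Real.log (f α) ≤ q * Real.log α := by
  obtain ⟨C, hC, hfC⟩ := hf.exists_pos
  filter_upwards [hpos, hfC.bound, eventually_gt_atTop 0,
    Real.tendsto_log_atTop.eventually_ge_atTop (Real.log C / (q - p))] with α hfα hle hα hlog
  rw [Real.norm_of_nonneg hfα.le, Real.norm_of_nonneg (Real.rpow_nonneg hα.le p)] at hle
  rw [div_le_iff₀ (sub_pos.2 hpq)] at hlog
  calc Real.log (f α) ≤ Real.log (C * α ^ p) := Real.log_le_log hfα hle
    _ = Real.log C + p * Real.log α := by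
        rw [Real.log_mul hC.ne' (Real.rpow_pos_of_pos hα p).ne', Real.log_rpow hα]
    _ ≤ q * Real.log α := by linarith

theorem isBigO_log_of_isBigO_rpow (hpos : ∀ᶠ α in atTop, 0 < f α)
    (hlower : (fun α => α ^ p) =O[atTop] f) (hupper : f =O[atTop] fun α => α ^ q) :
    (fun α => Real.log (f α)) =O[atTop] Real.log := by
  have hinv : (fun α => (f α)⁻¹) =O[atTop] fun α : ℝ => α ^ (-p) := by
    refine (hlower.inv_rev ?_).congr' .rfl ?_
    · filter_upwards [eventually_gt_atTop 0] with α hα h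
      exact absurd h (Real.rpow_pos_of_pos hα p).ne'
    · filter_upwards [eventually_gt_atTop 0] with α hα
      exact (Real.rpow_neg hα.le p).symm
  refine .of_bound (|p| + |q| + 1) ?_
  filter_upwards [eventually_log_le_of_isBigO_rpow hpos hupper (lt_add_one q),
    eventually_log_le_of_isBigO_rpow (hpos.mono fun _ => inv_pos.2) hinv (lt_add_one (-p)),
    eventually_ge_atTop 1] with α hle hge hα
  have hlogα := Real.log_nonneg hα
  rw [Real.log_inv] at hge
  rw [Real.norm_eq_abs, Real.norm_of_nonneg hlogα, abs_le]
  constructor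
  · nlinarith [neg_abs_le p, abs_nonneg q]
  · nlinarith [le_abs_self q, abs_nonneg p]

/-- The logarithm of `α ^ (2 s) / lam α`: the margin `M` reached by the kernel dynamics at time
`((1 - s) / lam α) log α`, at which the product scale is `α ^ (2 s) = lam α * exp M`. -/
noncomputable def logMargin (lam : ℝ → ℝ) (s α : ℝ) : ℝ :=
  2 * s * Real.log α - Real.log (lam α)

theorem exists_mul_log_le_logMargin (hpos : ∀ᶠ α in atTop, 0 < lam α)
    (hlam : lam =O[atTop] fun α => α ^ q) (hqs : q < 2 * s) :
    ∃ κ > 0, ∀ᶠ α in atTop, κ * Real.log α ≤ logMargin lam s α := by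
  obtain ⟨r, hqr, hrs⟩ := exists_between hqs
  refine ⟨2 * s - r, sub_pos.2 hrs, ?_⟩
  filter_upwards [eventually_log_le_of_isBigO_rpow hpos hlam hqr] with α hα
  rw [logMargin, sub_mul]
  gcongr

theorem tendsto_logMargin_atTop (hpos : ∀ᶠ α in atTop, 0 < lam α)
    (hlam : lam =O[atTop] fun α => α ^ q) (hqs : q < 2 * s) :
    Tendsto (logMargin lam s) atTop atTop := by
  obtain ⟨κ, hκ, hle⟩ := exists_mul_log_le_logMargin hpos hlam hqs
  exact tendsto_atTop_mono' _ hle (Real.tendsto_log_atTop.const_mul_atTop hκ)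

theorem isBigO_log_logMargin (hpos : ∀ᶠ α in atTop, 0 < lam α)
    (hlam : lam =O[atTop] fun α => α ^ q) (hqs : q < 2 * s) :
    Real.log =O[atTop] logMargin lam s := by
  obtain ⟨κ, hκ, hle⟩ := exists_mul_log_le_logMargin hpos hlam hqs
  refine .of_bound κ⁻¹ ?_
  filter_upwards [hle, eventually_ge_atTop 1] with α hα hα₁
  rw [Real.norm_of_nonneg (Real.log_nonneg hα₁), inv_mul_eq_div, le_div_iff₀' hκ]
  exact hα.trans (le_abs_self _)

theorem isBigO_logMargin_log (hpos : ∀ᶠ α in atTop, 0 < lam α)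
    (hlower : (fun α => α ^ p) =O[atTop] lam) (hupper : lam =O[atTop] fun α => α ^ q) :
    logMargin lam s =O[atTop] Real.log :=
  ((isBigO_refl Real.log atTop).const_mul_left (2 * s)).sub
    (isBigO_log_of_isBigO_rpow hpos hlower hupper)

theorem exp_neg_mul_div_mul_log {α l : ℝ} (hα : 0 < α) (hl : l ≠ 0) (s : ℝ) :
    Real.exp (-(2 * l) * (s / l * Real.log α)) = α ^ (-(2 * s)) := by
  rw [Real.rpow_def_of_pos hα]
  congr 1
  field_simp

theorem productScale_div_mul_log {α l : ℝ} (hα : 0 < α) (hl : l ≠ 0) (s : ℝ) :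
    productScale l α ((1 - s) / l * Real.log α) = α ^ (2 * s) := by
  rw [productScale, ← neg_mul, exp_neg_mul_div_mul_log hα hl, ← Real.rpow_two, ← Real.rpow_add hα]
  ring_nf

theorem sq_eq_mul_exp_logMargin {α : ℝ} (hα : 0 < α) (hl : 0 < lam α) :
    α ^ 2 = lam α * Real.exp (logMargin lam 1 α) := by
  rw [logMargin, mul_one, Real.exp_sub, Real.exp_log hl, mul_div_cancel₀ _ hl.ne',
    ← Real.log_rpow hα, Real.exp_log (Real.rpow_pos_of_pos hα 2), Real.rpow_two]

theorem logMargin_one_sub {α : ℝ} (hl : lam α ≠ 0) (s : ℝ) :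
    logMargin lam 1 α - 2 * lam α * ((1 - s) / lam α * Real.log α) = logMargin lam s α := by
  unfold logMargin
  field_simp
  ring

theorem isLittleO_trackingError_logMargin {n : ℕ} {N : ℝ} (hn : 0 < n) (hN : 0 < N)
    (hpos : ∀ᶠ α in atTop, 0 < lam α) (hlower : (fun α => α ^ p) =O[atTop] lam)
    (hupper : lam =O[atTop] fun α => α ^ q) (hqs : q < 2 * s) :
    (fun α => trackingError n N (logMargin lam s α)) =o[atTop] fun α => Real.log α ^ 2 :=
  ((isLittleO_trackingError_sq hn hN).comp_tendsto
    (tendsto_logMargin_atTop hpos hupper hqs)).trans_isBigO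
      ((isBigO_logMargin_log hpos hlower hupper).pow 2)

theorem isLittleO_tracking_bound {n : ℕ} {N : ℝ} (hn : 0 < n) (hN : 0 < N) (hc : c < 1)
    (hpos : ∀ᶠ α in atTop, 0 < lam α) (hlower : (fun α => α ^ p) =O[atTop] lam)
    (hupper : lam =O[atTop] fun α => α ^ q) (hq : q < 2) :
    (fun α => 2 * (N * logMargin lam 1 α ^ 2 * α ^ (-(2 * (1 - c))) +
      trackingError n N (logMargin lam 1 α)) + 2) =o[atTop] fun α => Real.log α ^ 2 := by
  have hdecay : (fun α : ℝ => α ^ (-(2 * (1 - c)))) =o[atTop] fun _ => (1 : ℝ) :=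
    (isLittleO_one_iff ℝ).2 (tendsto_rpow_neg_atTop (by linarith))
  have hinit : (fun α => N * logMargin lam 1 α ^ 2 * α ^ (-(2 * (1 - c)))) =o[atTop]
      fun α => Real.log α ^ 2 := by
    simpa only [mul_one] using
      ((((isBigO_logMargin_log hpos hlower hupper).pow 2).const_mul_left N).mul_isLittleO hdecay)
  have hconst : (fun _ => (2 : ℝ)) =o[atTop] fun α => Real.log α ^ 2 :=
    isLittleO_const_left.2 <| Or.inr <| tendsto_norm_atTop_atTop.comp <|
      (tendsto_pow_atTop two_ne_zero).comp Real.tendsto_log_atTop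
  exact ((hinit.add (isLittleO_trackingError_logMargin hn hN hpos hlower hupper
    (by linarith))).const_mul_left 2).add hconst

theorem eventually_kernel_scale_le {n : ℕ} {N : ℝ} (hn : 0 < n) (hN : 0 < N) (hc : 0 < c)
    (hpos : ∀ᶠ α in atTop, 0 < lam α) (hlower : (fun α => α ^ p) =O[atTop] lam)
    (hupper : lam =O[atTop] fun α => α ^ q) (hq : q < 2) (Z : ℝ) :
    ∀ᶠ α in atTop, Z * (4 * N * logMargin lam 1 α ^ 2 +
      2 * trackingError n N (logMargin lam 1 α)) ≤ 2 * α ^ (2 * c) := by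
  have hlog : (fun α => Real.log α ^ 2) =o[atTop] fun α : ℝ => α ^ (2 * c) := by
    refine ((isLittleO_log_rpow_atTop hc).pow two_pos).congr' .rfl ?_
    filter_upwards [eventually_ge_atTop 0] with α hα
    rw [← Real.rpow_mul_natCast hα, Nat.cast_two, mul_comm]
  have hleft : (fun α => Z * (4 * N * logMargin lam 1 α ^ 2 +
      2 * trackingError n N (logMargin lam 1 α))) =O[atTop] fun α => Real.log α ^ 2 :=
    ((((isBigO_logMargin_log hpos hlower hupper).pow 2).const_mul_left (4 * N)).add
      ((isLittleO_trackingError_logMargin hn hN hpos hlower hupper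
        (by linarith)).isBigO.const_mul_left 2)).const_mul_left Z
  filter_upwards [(hleft.trans_isLittleO hlog).bound two_pos, eventually_ge_atTop 0] with α hle hα
  rw [Real.norm_of_nonneg (Real.rpow_nonneg hα _)] at hle
  exact (le_abs_self _).trans hle

theorem IsHardMarginVector.isLittleO_effectiveWeight_sub_smul {d : ℕ} {ι : Type*} [Fintype ι]
    [Nonempty ι] {z : ι → EuclideanSpace ℝ (Fin d)} {v : EuclideanSpace ℝ (Fin d)}
    (hv : IsHardMarginVector z v) (hc : c ∈ Ioo (0 : ℝ) 1)
    (hpos : ∀ᶠ α in atTop, 0 < lam α) (hlower : (fun α => α ^ p) =O[atTop] lam)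
    (hupper : lam =O[atTop] fun α => α ^ q) (hq : q < 2 * c) {θ : ℝ → ℝ → Param d}
    (hθ₀ : ∀ᶠ α in atTop, θ α 0 = α • initDirection d)
    (hθ : ∀ᶠ α in atTop, ∀ t, 0 ≤ t →
      HasDerivWithinAt (θ α) (flowField z (lam α) (θ α t)) (Ici 0) t) :
    (fun α => effectiveWeight (θ α ((1 - c) / lam α * Real.log α)) - logMargin lam c α • v)
      =o[atTop] logMargin lam c := by
  obtain ⟨Z, hZ, hz⟩ : ∃ Z, 1 ≤ Z ∧ ∀ i, ‖z i‖ ≤ Z := by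
    obtain ⟨j, hj⟩ := Finite.exists_max fun i => ‖z i‖
    exact ⟨max 1 ‖z j‖, le_max_left _ _, fun i => (hj i).trans (le_max_right _ _)⟩
  have hN : 0 < ‖v‖ ^ 2 := pow_pos (norm_pos_iff.2 hv.ne_zero) 2
  have hn : 0 < Fintype.card ι := Fintype.card_pos
  have hq₂ : q < 2 := by linarith [hc.2]
  have hmargin := tendsto_logMargin_atTop hpos hupper hq
  have hlarge : ∀ᶠ α in atTop,
      Real.exp 2 ≤ Fintype.card ι * logMargin lam c α * ‖v‖ ^ 2 / 2 :=
    (((hmargin.const_mul_atTop (Nat.cast_pos.2 hn)).atTop_mul_const hN).atTop_div_const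
      two_pos).eventually_ge_atTop _
  suffices hsq : (fun α => ‖effectiveWeight (θ α ((1 - c) / lam α * Real.log α)) -
      logMargin lam c α • v‖ ^ 2) =o[atTop] fun α => Real.log α ^ 2 from
    (isLittleO_norm_left.1 (hsq.of_pow two_ne_zero)).trans_isBigO
      (isBigO_log_logMargin hpos hupper hq)
  refine (IsBigO.of_bound' ?_).trans_isLittleO
    (isLittleO_tracking_bound hn hN hc.2 hpos hlower hupper hq₂)
  filter_upwards [hpos, hθ₀, hθ, hlarge, hmargin.eventually_gt_atTop 0,
    eventually_kernel_scale_le hn hN hc.1 hpos hlower hupper hq₂ Z, eventually_ge_atTop 1]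
    with α hl hα₀ hflow hαlarge hα_margin hαscale hα₁
  have hα : 0 < α := one_pos.trans_le hα₁
  have hT : 0 ≤ (1 - c) / lam α * Real.log α :=
    mul_nonneg (div_nonneg (sub_nonneg.2 hc.2.le) hl.le) (Real.log_nonneg hα₁)
  have hbound := hv.norm_effectiveWeight_sub_smul_sq_le hl (sq_eq_mul_exp_logMargin hα hl) hT
    (by rwa [logMargin_one_sub hl.ne']) (by rwa [logMargin_one_sub hl.ne']) hZ hz
    (by rwa [productScale_div_mul_log hα hl.ne']) hα₀ hflow
  rw [logMargin_one_sub hl.ne', exp_neg_mul_div_mul_log hα hl.ne'] at hbound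
  rw [norm_pow, norm_norm]
  exact hbound.trans (le_abs_self _)

end Asymptotics

end DiagNet

theorem mainTheorem8_general {d n : ℕ} (hn : 1 ≤ n)
    (x : Fin n → EuclideanSpace ℝ (Fin d)) (y : Fin n → ℝ)
    (hsep : ∃ w : EuclideanSpace ℝ (Fin d), ∀ i, 0 < y i * inner ℝ w (x i))
    (p q : ℝ) (lam : ℝ → ℝ) (hlam_pos : ∀ α : ℝ, 0 < α → 0 < lam α)
    (hlower : (fun α : ℝ => α ^ p) =O[Filter.atTop] lam)
    (hupper : lam =O[Filter.atTop] fun α : ℝ => α ^ q)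
    (c : ℝ) (hc : c ∈ Set.Ioo (0 : ℝ) 1) (hq : q < 2 * c) :
    ∃ w₂ : EuclideanSpace ℝ (Fin d),
      DiagNet.maxL2MarginDirections x y = {w₂} ∧
      (∀ α : ℝ, 0 < α → ∃ θ : ℝ → DiagNet.Param d,
        DiagNet.IsGradientFlow (DiagNet.regLoss x y (lam α)) (α • DiagNet.initDirection d) θ) ∧
      ∀ θ : ℝ → ℝ → DiagNet.Param d,
        (∀ α : ℝ, 0 < α →
          DiagNet.IsGradientFlow (DiagNet.regLoss x y (lam α))
            (α • DiagNet.initDirection d) (θ α)) →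
        Filter.Tendsto
          (fun α : ℝ =>
            ‖DiagNet.effectiveWeight (θ α ((1 - c) / lam α * Real.log α))‖⁻¹ •
              DiagNet.effectiveWeight (θ α ((1 - c) / lam α * Real.log α)))
          Filter.atTop (nhds w₂) := by
  have : Nonempty (Fin n) := Fin.pos_iff_nonempty.1 hn
  obtain ⟨v, hv⟩ : ∃ v, DiagNet.IsHardMarginVector (fun i => y i • x i) v :=
    DiagNet.exists_isHardMarginVector (by simpa only [real_inner_smul_right] using hsep)
  refine ⟨‖v‖⁻¹ • v, DiagNet.maxL2MarginDirections_eq_singleton hv,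
    fun α hα => DiagNet.exists_isGradientFlow_regLoss (hlam_pos α hα) _, fun θ hθ => ?_⟩
  have hpos : ∀ᶠ α in Filter.atTop, 0 < lam α := (Filter.eventually_gt_atTop 0).mono hlam_pos
  have hflow := (Filter.eventually_gt_atTop 0).mono fun α hα =>
    DiagNet.isGradientFlow_regLoss_iff.1 (hθ α hα)
  exact DiagNet.tendsto_inv_norm_smul_of_isLittleO hv.ne_zero
    ((DiagNet.tendsto_logMargin_atTop hpos hupper hq).eventually_gt_atTop 0)
    (hv.isLittleO_effectiveWeight_sub_smul hc hpos hlower hupper hq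
      (hflow.mono fun _ h => h.1) (hflow.mono fun _ h => h.2))

theorem mainTheorem8 {d n : ℕ} (hn : 1 ≤ n)
    (x : Fin n → EuclideanSpace ℝ (Fin d)) (y : Fin n → ℝ)
    (hy : ∀ i, y i = 1 ∨ y i = -1)
    (hsep : ∃ w : EuclideanSpace ℝ (Fin d), ∀ i, 0 < y i * inner ℝ w (x i))
    (p : ℝ) (hp : 0 < p) (lam : ℝ → ℝ) (hlam_pos : ∀ α : ℝ, 0 < α → 0 < lam α)
    (hlam : lam =Θ[Filter.atTop] fun α : ℝ => α ^ (-p))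
    (c : ℝ) (hc : c ∈ Set.Ioo (0 : ℝ) 1) :
    ∃ w₂ : EuclideanSpace ℝ (Fin d),
      DiagNet.maxL2MarginDirections x y = {w₂} ∧
      (∀ α : ℝ, 0 < α → ∃ θ : ℝ → DiagNet.Param d,
        DiagNet.IsGradientFlow (DiagNet.regLoss x y (lam α)) (α • DiagNet.initDirection d) θ) ∧
      ∀ θ : ℝ → ℝ → DiagNet.Param d,
        (∀ α : ℝ, 0 < α →
          DiagNet.IsGradientFlow (DiagNet.regLoss x y (lam α))
            (α • DiagNet.initDirection d) (θ α)) →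
        Filter.Tendsto
          (fun α : ℝ =>
            ‖DiagNet.effectiveWeight (θ α ((1 - c) / lam α * Real.log α))‖⁻¹ •
              DiagNet.effectiveWeight (θ α ((1 - c) / lam α * Real.log α)))
          Filter.atTop (nhds w₂) :=
  mainTheorem8_general hn x y hsep (-p) (-p) lam hlam_pos hlam.2 hlam.1 c hc (by linarith [hc.1])
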